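/- There is an absolute constant $C>0$ such that the following holds. Let $\pi$ be a permutation of $\{1,\dots,k\}$, $k\ge 1$. A 0-1 matrix contains $\pi$ if some submatrix of it (obtained by deleting rows and columns) has an entry $1$ at every position where the permutation matrix of $\pi$ has one, and otherwise avoids $\pi$; let $\mathrm{ex}_\pi(n)$ be the maximum number of ones in an $n\times n$ 0-1 matrix that avoids $\pi$. Then the Füredi–Hajnal limit $c_\pi=\lim_{n\to\infty}\frac1n\,\mathrm{ex}_\pi(n)$ exists and is finite, and every finite point set $P\subset[0,1]^2$ in general position (no two points of $P$ share an $x$- or a $y$-coordinate) that avoids $\pi$ satisfies $$\mathrm{TSP}(P)\le C\,c_\pi\,\log|P|,$$ where $\mathrm{TSP}(P)$ is the euclidean length of a shortest closed tour through all points of $P$, the right-hand side is read as $0$ for $P=\emptyset$, and $P$ avoids $\pi$ if there are no points $p_1,\dots,p_k\in P$, listed with increasing $x$-coordinates, whose $y$-coordinates satisfy $y(p_i)<y(p_j)\Leftrightarrow\pi(i)<\pi(j)$ for all $i,j$. -/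

import Mathlib

open Filter Topology

noncomputable section

namespace PatternTSP

/-! ### 0-1 matrices, pattern containment and the Füredi-Hajnal limit -/

/-- A 0-1 matrix with `m` rows and `n` columns (`true` is the entry 1). -/
abbrev ZeroOneMatrix (m n : ℕ) : Type := Matrix (Fin m) (Fin n) Bool

/-- `M` contains `Q`: a submatrix of `M` (order-preserving choice of rows and columns) has an entry 1
wherever `Q` has one. -/
def MatrixContains {m n k l : ℕ} (M : ZeroOneMatrix m n) (Q : ZeroOneMatrix k l) : Prop :=
  ∃ (r : Fin k ↪o Fin m) (s : Fin l ↪o Fin n), ∀ i j, Q i j = true → M (r i) (s j) = true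

/-- The permutation matrix of `π`: the 1 of column `j` is in row `π j`. -/
def permMatrix {k : ℕ} (π : Equiv.Perm (Fin k)) : ZeroOneMatrix k k :=
  fun i j => decide (i = π j)

/-- The number of ones of a 0-1 matrix. -/
def ones {m n : ℕ} (M : ZeroOneMatrix m n) : ℕ :=
  (Finset.univ.filter fun e : Fin m × Fin n => M e.1 e.2 = true).card

open Classical in
/-- `ex π n` is the maximum number of ones in an `n × n` 0-1 matrix that avoids `π`. -/
def ex {k : ℕ} (π : Equiv.Perm (Fin k)) (n : ℕ) : ℕ :=
  (Finset.univ.filter fun M : ZeroOneMatrix n n => ¬ MatrixContains M (permMatrix π)).sup ones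

/-- The Füredi-Hajnal limit `c_π = lim ex_π(n) / n`. -/
def furediHajnalLimit {k : ℕ} (π : Equiv.Perm (Fin k)) : ℝ :=
  limUnder atTop fun n : ℕ => (ex π n : ℝ) / n

/-! ### Planar point sets -/

/-- The euclidean plane. -/
abbrev Plane : Type := EuclideanSpace ℝ (Fin 2)

/-- `P ⊆ [0,1]²`. -/
def InUnitSquare (P : Finset Plane) : Prop :=
  ∀ p ∈ P, p 0 ∈ Set.Icc (0 : ℝ) 1 ∧ p 1 ∈ Set.Icc (0 : ℝ) 1

/-- No two points of `P` share an x- or a y-coordinate. -/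
def GeneralPosition (P : Finset Plane) : Prop :=
  ∀ p ∈ P, ∀ q ∈ P, p ≠ q → p 0 ≠ q 0 ∧ p 1 ≠ q 1

/-- `P` contains `π`: there are `k` points of `P` whose y-coordinates, read from left to right, form
a sequence that is order-isomorphic to `π`. -/
def PointSetContains {k : ℕ} (P : Finset Plane) (π : Equiv.Perm (Fin k)) : Prop :=
  ∃ f : Fin k → Plane, (∀ i, f i ∈ P) ∧ StrictMono (fun i => f i 0) ∧
    ∀ i j, f i 1 < f j 1 ↔ π i < π j

/-- `P` avoids `π`. -/
def PointSetAvoids {k : ℕ} (P : Finset Plane) (π : Equiv.Perm (Fin k)) : Prop :=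
  ¬ PointSetContains P π

/-- The euclidean length of the closed tour that visits the points of `P` in the order `σ` and then
returns to its start (`finRotate` is the cyclic successor on `Fin n`). -/
def tourLength (P : Finset Plane) (σ : Fin P.card ≃ P) : ℝ :=
  ∑ i, dist (σ i : Plane) (σ (finRotate P.card i) : Plane)

/-- The length of a shortest closed tour through `P` (a minimum over a finite nonempty set). -/
def tsp (P : Finset Plane) : ℝ :=
  ⨅ σ : Fin P.card ≃ P, tourLength P σ

end PatternTSP

end

namespace PatternTSP

/-! Lay a grid of mesh `1 / N` over the square. A pattern formed by nonempty cells lifts to points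
of `P`, so the 0-1 matrix of nonempty cells avoids `π` and has at most `c_π * (N + 1)` ones
(`card_image_cell_le`). Build a path by refining dyadic grids: at each level the representatives of
the new cells are inserted next to a nearby point already on the path, at a cost proportional to the
previous mesh. Number of cells times mesh is `O(c_π)`, so each level costs `O(c_π)`
(`exists_path_of_grid`). After about `log₂ |P|` levels, the remaining points are inserted at bounded
total cost, and closing the path at most doubles its length.

The count needs `ex π n ≤ c_π * n` for every `n`, not only asymptotically. Superadditivity
(`ex_add_le`) and Fekete's lemma give this, since the limit is then a supremum; the Marcus-Tardos
theorem makes it finite. -/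

/-! ### Patterns in finite sets of lattice points -/

/-- The set `E` of (row, column) positions contains the pattern `π`. -/
def Occurs {k : ℕ} (E : Finset (ℕ × ℕ)) (π : Equiv.Perm (Fin k)) : Prop :=
  ∃ r c : Fin k → ℕ, StrictMono r ∧ StrictMono c ∧ ∀ j, (r (π j), c j) ∈ E

/-- The positions of an `n × n` matrix. -/
def square (n : ℕ) : Finset (ℕ × ℕ) := Finset.range n ×ˢ Finset.range n

theorem mem_square {n : ℕ} {e : ℕ × ℕ} : e ∈ square n ↔ e.1 < n ∧ e.2 < n := by
  simp [square]

theorem square_subset {m n : ℕ} (h : m ≤ n) : square m ⊆ square n := by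
  intro e he
  rw [mem_square] at *
  omega

theorem not_occurs_empty {k : ℕ} (hk : 1 ≤ k) (π : Equiv.Perm (Fin k)) : ¬ Occurs ∅ π := by
  rintro ⟨r, c, -, -, h⟩
  simpa using h ⟨0, hk⟩

theorem occurs_swap {k : ℕ} {E : Finset (ℕ × ℕ)} {π : Equiv.Perm (Fin k)}
    (h : Occurs (E.image Prod.swap) π⁻¹) : Occurs E π := by
  obtain ⟨r, c, hr, hc, h⟩ := h
  refine ⟨c, r, hc, hr, fun j => ?_⟩
  have := h (π j)
  obtain ⟨e, he, hej⟩ := Finset.mem_image.1 this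
  obtain rfl : e = (c (π j), r j) := by rw [← Prod.swap_swap e, hej]; simp
  exact he

/-- Positions with prescribed row order and column order give an occurrence. -/
theorem occurs_of_choice {k : ℕ} {E : Finset (ℕ × ℕ)} {π : Equiv.Perm (Fin k)}
    (g : Fin k → ℕ × ℕ) (hg : ∀ j, g j ∈ E) (hc : ∀ i j, i < j → (g i).2 < (g j).2)
    (hr : ∀ i j, π i < π j → (g i).1 < (g j).1) : Occurs E π := by
  refine ⟨fun i => (g (π⁻¹ i)).1, fun j => (g j).2, ?_, fun i j h => hc i j h, fun j => ?_⟩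
  · intro i j h
    exact hr _ _ (by simpa using h)
  · simpa using hg j

/-! ### The Marcus-Tardos theorem -/

/-- The nonempty blocks of side `s`. -/
def blocks (s : ℕ) (E : Finset (ℕ × ℕ)) : Finset (ℕ × ℕ) :=
  E.image fun e => (e.1 / s, e.2 / s)

/-- The part of `E` in the block `b`. -/
def inBlock (s : ℕ) (E : Finset (ℕ × ℕ)) (b : ℕ × ℕ) : Finset (ℕ × ℕ) :=
  E.filter fun e => (e.1 / s, e.2 / s) = b

theorem occurs_of_blocks {k s : ℕ} {E : Finset (ℕ × ℕ)} {π : Equiv.Perm (Fin k)}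
    (h : Occurs (blocks s E) π) : Occurs E π := by
  obtain ⟨r, c, hr, hc, h⟩ := h
  simp only [blocks, Finset.mem_image, Prod.mk.injEq] at h
  choose g hg h1 h2 using h
  refine occurs_of_choice g hg (fun i j hij => ?_) (fun i j hij => ?_)
  · exact Nat.lt_of_div_lt_div (by rw [h2, h2]; exact hc hij)
  · exact Nat.lt_of_div_lt_div (by rw [h1, h1]; exact hr hij)

theorem blocks_subset {s m : ℕ} {E : Finset (ℕ × ℕ)} (hE : E ⊆ square (m * s)) :
    blocks s E ⊆ square m := by
  intro b hb
  obtain ⟨e, he, rfl⟩ := Finset.mem_image.1 hb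
  have := mem_square.1 (hE he)
  exact mem_square.2 ⟨Nat.div_lt_of_lt_mul (by linarith), Nat.div_lt_of_lt_mul (by linarith)⟩

/-- The blocks with at least `k` nonempty columns. -/
def wideBlocks (k s : ℕ) (E : Finset (ℕ × ℕ)) : Finset (ℕ × ℕ) :=
  (blocks s E).filter fun b => k ≤ ((inBlock s E b).image Prod.snd).card

/-- Pigeonhole over the `2 ^ s` possible sets of nonempty columns: too many wide blocks would leave
`k` of them, one above another, with the same nonempty columns. Each of these blocks then offers an
entry in any chosen one of `k` common columns, which realizes every pattern. -/
theorem card_wideBlocks_column {k s : ℕ} (hs : 0 < s) {E : Finset (ℕ × ℕ)}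
    {π : Equiv.Perm (Fin k)} (h : ¬ Occurs E π) (J : ℕ) :
    ((wideBlocks k s E).filter fun b => b.2 = J).card ≤ 2 ^ s * k := by
  by_contra! hlt
  apply h
  have hmaps : ∀ b ∈ (wideBlocks k s E).filter fun b => b.2 = J,
      (inBlock s E b).image Prod.snd ∈ (Finset.Ico (s * J) (s * J + s)).powerset := by
    intro b hb
    rw [Finset.mem_powerset]
    intro y hy
    simp only [inBlock, Finset.mem_image, Finset.mem_filter] at hy hb
    obtain ⟨e, ⟨-, he⟩, rfl⟩ := hy
    have : e.2 / s = J := by rw [← hb.2, ← he]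
    have h1 := Nat.div_add_mod e.2 s
    have h2 := Nat.mod_lt e.2 hs
    rw [this] at h1
    rw [Finset.mem_Ico]
    omega
  obtain ⟨Y, -, hY⟩ := Finset.exists_lt_card_fiber_of_mul_lt_card_of_maps_to hmaps
    (n := k) (by simpa using hlt)
  set F := ((wideBlocks k s E).filter fun b => b.2 = J).filter
    fun b => (inBlock s E b).image Prod.snd = Y with hF
  have hinj : Set.InjOn Prod.fst (F : Set (ℕ × ℕ)) := by
    intro a ha b hb hab
    have ha2 := (Finset.mem_filter.1 (Finset.mem_filter.1 ha).1).2
    have hb2 := (Finset.mem_filter.1 (Finset.mem_filter.1 hb).1).2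
    exact Prod.ext hab (ha2.trans hb2.symm)
  have hcard : k ≤ (F.image Prod.fst).card := by
    rw [Finset.card_image_of_injOn hinj]; exact hY.le
  have hYcard : k ≤ Y.card := by
    obtain ⟨b, hb⟩ := Finset.card_pos.1 (lt_of_le_of_lt (Nat.zero_le _) hY)
    obtain ⟨hb, hbY⟩ := Finset.mem_filter.1 hb
    rw [← hbY]
    exact (Finset.mem_filter.1 (Finset.mem_filter.1 hb).1).2
  let I := Finset.orderEmbOfCardLe _ hcard
  let c := Finset.orderEmbOfCardLe _ hYcard
  have hex : ∀ j, ∃ e ∈ E, e.1 / s = I (π j) ∧ e.2 = c j := by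
    intro j
    have h1 : I (π j) ∈ F.image Prod.fst := Finset.orderEmbOfCardLe_mem _ hcard _
    have h2 : c j ∈ Y := Finset.orderEmbOfCardLe_mem _ hYcard _
    obtain ⟨b, hb, hbI⟩ := Finset.mem_image.1 h1
    rw [← (Finset.mem_filter.1 hb).2] at h2
    simp only [inBlock, Finset.mem_image, Finset.mem_filter] at h2
    obtain ⟨e, ⟨he, hbe⟩, hec⟩ := h2
    exact ⟨e, he, by rw [← hbI, ← hbe], hec⟩
  choose g hg h1 h2 using hex
  refine occurs_of_choice g hg (fun i j hij => ?_) (fun i j hij => ?_)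
  · rw [h2, h2]; exact c.strictMono hij
  · exact Nat.lt_of_div_lt_div (by rw [h1, h1]; exact I.strictMono hij)

theorem card_wideBlocks {k s m : ℕ} (hs : 0 < s) {E : Finset (ℕ × ℕ)}
    (hE : E ⊆ square (m * s)) {π : Equiv.Perm (Fin k)} (h : ¬ Occurs E π) :
    (wideBlocks k s E).card ≤ 2 ^ s * k * m := by
  have := Finset.card_le_mul_card_image_of_maps_to (s := wideBlocks k s E)
    (t := Finset.range m) (f := Prod.snd) (fun b hb => by
      have := mem_square.1 (blocks_subset hE (Finset.mem_filter.1 hb).1)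
      simpa using this.2) (2 ^ s * k) (fun J _ => card_wideBlocks_column hs h J)
  simpa using this

theorem card_inBlock_le {s : ℕ} (hs : 0 < s) (E : Finset (ℕ × ℕ)) (b : ℕ × ℕ) :
    (inBlock s E b).card ≤ s ^ 2 := by
  have : inBlock s E b ⊆
      Finset.Ico (s * b.1) (s * b.1 + s) ×ˢ Finset.Ico (s * b.2) (s * b.2 + s) := by
    intro e he
    obtain ⟨-, rfl⟩ := Finset.mem_filter.1 he
    have h1 := Nat.div_add_mod e.1 s
    have h2 := Nat.mod_lt e.1 hs
    have h3 := Nat.div_add_mod e.2 s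
    have h4 := Nat.mod_lt e.2 hs
    simp only [Finset.mem_product, Finset.mem_Ico]
    omega
  refine (Finset.card_le_card this).trans ?_
  simp [sq]

theorem card_le_card_rows_mul_card_columns (F : Finset (ℕ × ℕ)) :
    F.card ≤ (F.image Prod.fst).card * (F.image Prod.snd).card := by
  rw [← Finset.card_product]
  exact Finset.card_le_card Finset.subset_product

theorem inBlock_swap (s : ℕ) (E : Finset (ℕ × ℕ)) (b : ℕ × ℕ) :
    inBlock s (E.image Prod.swap) b.swap = (inBlock s E b).image Prod.swap := by
  ext ⟨x, y⟩
  simp [inBlock, Prod.ext_iff, and_comm]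

theorem blocks_swap (s : ℕ) (E : Finset (ℕ × ℕ)) :
    blocks s (E.image Prod.swap) = (blocks s E).image Prod.swap := by
  simp [blocks, Finset.image_image, Function.comp_def]

/-- A block that is neither wide nor tall has at most `k` nonempty rows and `k` nonempty columns,
hence at most `k ^ 2` entries. Tall blocks are the wide blocks of the transpose, which avoids `π⁻¹`.
-/
theorem card_le_of_blocks {k s m : ℕ} (hs : 0 < s) {E : Finset (ℕ × ℕ)}
    (hE : E ⊆ square (m * s)) {π : Equiv.Perm (Fin k)} (h : ¬ Occurs E π) :
    E.card ≤ k ^ 2 * (blocks s E).card + 2 * (s ^ 2 * (2 ^ s * k * m)) := by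
  have hE' : E.image Prod.swap ⊆ square (m * s) := by
    intro e he
    obtain ⟨e₀, he₀, rfl⟩ := Finset.mem_image.1 he
    exact mem_square.2 (mem_square.1 (hE he₀)).symm
  have hW := card_wideBlocks hs hE h
  have hT := card_wideBlocks hs hE' (fun h' => h (occurs_swap h'))
  rw [← Finset.card_image_of_injective _ Prod.swap_injective] at hT
  set W := wideBlocks k s E
  set T := (wideBlocks k s (E.image Prod.swap)).image Prod.swap with hTdef
  have hsum : E.card = ∑ b ∈ blocks s E, (inBlock s E b).card :=
    Finset.card_eq_sum_card_fiberwise fun e he => Finset.mem_image_of_mem _ he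
  have hb : ∀ b ∈ blocks s E, (inBlock s E b).card ≤
      k ^ 2 + ((if b ∈ W then s ^ 2 else 0) + if b ∈ T then s ^ 2 else 0) := by
    intro b hb
    have hle := card_inBlock_le hs E b
    by_cases hbW : b ∈ W
    · rw [if_pos hbW]; omega
    by_cases hbT : b ∈ T
    · rw [if_pos hbT]; omega
    rw [if_neg hbW, if_neg hbT]
    have h1 : ((inBlock s E b).image Prod.snd).card ≤ k := by
      by_contra! hk
      exact hbW (Finset.mem_filter.2 ⟨hb, hk.le⟩)
    have h2 : ((inBlock s E b).image Prod.fst).card ≤ k := by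
      by_contra! hk
      refine hbT (Finset.mem_image.2 ⟨b.swap, Finset.mem_filter.2 ⟨?_, ?_⟩, by simp⟩)
      · rw [blocks_swap]; exact Finset.mem_image_of_mem _ hb
      · rw [inBlock_swap, Finset.image_image]
        exact hk.le
    have := (card_le_card_rows_mul_card_columns (inBlock s E b)).trans (Nat.mul_le_mul h2 h1)
    rw [sq]; omega
  have hind : ∀ V : Finset (ℕ × ℕ),
      ∑ b ∈ blocks s E, (if b ∈ V then s ^ 2 else 0) ≤ s ^ 2 * V.card := by
    intro V
    rw [← Finset.sum_filter, Finset.sum_const, smul_eq_mul, mul_comm]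
    gcongr
    intro b hb
    exact (Finset.mem_filter.1 hb).2
  calc E.card ≤ ∑ b ∈ blocks s E,
        (k ^ 2 + ((if b ∈ W then s ^ 2 else 0) + if b ∈ T then s ^ 2 else 0)) := by
        rw [hsum]; exact Finset.sum_le_sum hb
    _ ≤ (blocks s E).card * k ^ 2 + (s ^ 2 * W.card + s ^ 2 * T.card) := by
        rw [Finset.sum_add_distrib, Finset.sum_add_distrib, Finset.sum_const, smul_eq_mul]
        exact Nat.add_le_add_left (Nat.add_le_add (hind W) (hind T)) _
    _ ≤ k ^ 2 * (blocks s E).card + 2 * (s ^ 2 * (2 ^ s * k * m)) := by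
        have h1 := Nat.mul_le_mul_left (s ^ 2) hW
        have h2 := Nat.mul_le_mul_left (s ^ 2) hT
        rw [mul_comm (k ^ 2)]; omega

/-- The linear bound for square matrices whose side is a power of `k ^ 2 + 1`. -/
theorem card_le_of_not_occurs_pow {k : ℕ} (hk : 1 ≤ k) (π : Equiv.Perm (Fin k)) (t : ℕ) :
    ∀ E ⊆ square ((k ^ 2 + 1) ^ t), ¬ Occurs E π →
      E.card ≤ 2 * ((k ^ 2 + 1) ^ 2 * (2 ^ (k ^ 2 + 1) * k)) * (k ^ 2 + 1) ^ t := by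
  set s := k ^ 2 + 1 with hs
  induction t with
  | zero =>
    intro E hE _
    have h1 : E.card ≤ 1 := by simpa [square] using Finset.card_le_card hE
    have h2 : 0 < 2 * (s ^ 2 * (2 ^ s * k)) * s ^ 0 := by positivity
    omega
  | succ t ih =>
    intro E hE h
    rw [pow_succ] at hE
    have h1 := card_le_of_blocks (by omega) hE h
    have h2 := ih _ (blocks_subset hE) (fun h' => h (occurs_of_blocks h'))
    -- With `A` the claimed constant, the block bound reads `k ^ 2 * A + A = A * s`: side `k ^ 2 +
    -- 1` is just large enough for the recursion to stay linear.
    calc E.card ≤ k ^ 2 * (2 * (s ^ 2 * (2 ^ s * k)) * s ^ t) +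
          2 * (s ^ 2 * (2 ^ s * k * s ^ t)) := h1.trans (by gcongr)
      _ = 2 * (s ^ 2 * (2 ^ s * k)) * (s ^ t * (k ^ 2 + 1)) := by ring
      _ = _ := by rw [← hs, ← pow_succ]

/-- The Marcus-Tardos theorem. -/
theorem exists_card_le_of_not_occurs {k : ℕ} (hk : 1 ≤ k) (π : Equiv.Perm (Fin k)) :
    ∃ K : ℕ, ∀ n, ∀ E ⊆ square n, ¬ Occurs E π → E.card ≤ K * n := by
  refine ⟨2 * ((k ^ 2 + 1) ^ 2 * (2 ^ (k ^ 2 + 1) * k)) * (k ^ 2 + 1), fun n E hE h => ?_⟩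
  rcases Nat.eq_zero_or_pos n with rfl | hn
  · have : E.card ≤ 0 := by simpa [square] using Finset.card_le_card hE
    omega
  have hs : 1 < k ^ 2 + 1 := Nat.lt_add_of_pos_left (by positivity)
  have h1 := card_le_of_not_occurs_pow hk π (Nat.log (k ^ 2 + 1) n + 1) E
    (hE.trans (square_subset (Nat.lt_pow_succ_log_self hs n).le)) h
  refine h1.trans ?_
  rw [mul_assoc _ (k ^ 2 + 1) n, pow_succ' _ (Nat.log _ _)]
  refine Nat.mul_le_mul_left _ (Nat.mul_le_mul_left _ ?_)
  exact Nat.pow_log_le_self _ hn.ne'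

/-! ### The extremal function -/

/-- The positions of the ones of a matrix. -/
def positions {n : ℕ} (M : ZeroOneMatrix n n) : Finset (ℕ × ℕ) :=
  (Finset.univ.filter fun e : Fin n × Fin n => M e.1 e.2 = true).image
    fun e => ((e.1 : ℕ), (e.2 : ℕ))

/-- The matrix with ones at the positions in `E`. -/
def ofPositions (n : ℕ) (E : Finset (ℕ × ℕ)) : ZeroOneMatrix n n :=
  fun i j => decide (((i : ℕ), (j : ℕ)) ∈ E)

theorem card_positions {n : ℕ} (M : ZeroOneMatrix n n) : (positions M).card = ones M := by
  refine Finset.card_image_of_injective _ fun a b h => ?_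
  simp only [Prod.mk.injEq] at h
  exact Prod.ext (Fin.ext h.1) (Fin.ext h.2)

theorem mem_positions {n : ℕ} {M : ZeroOneMatrix n n} {x y : ℕ} :
    (x, y) ∈ positions M ↔ ∃ (hx : x < n) (hy : y < n), M ⟨x, hx⟩ ⟨y, hy⟩ = true := by
  simp only [positions, Finset.mem_image, Finset.mem_filter, Finset.mem_univ, true_and,
    Prod.mk.injEq]
  constructor
  · rintro ⟨e, he, rfl, rfl⟩
    exact ⟨e.1.2, e.2.2, he⟩
  · rintro ⟨hx, hy, h⟩
    exact ⟨(⟨x, hx⟩, ⟨y, hy⟩), h, rfl, rfl⟩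

theorem positions_subset {n : ℕ} (M : ZeroOneMatrix n n) : positions M ⊆ square n := by
  rintro ⟨x, y⟩ h
  obtain ⟨hx, hy, -⟩ := mem_positions.1 h
  exact mem_square.2 ⟨hx, hy⟩

theorem positions_ofPositions {n : ℕ} {E : Finset (ℕ × ℕ)} (hE : E ⊆ square n) :
    positions (ofPositions n E) = E := by
  ext ⟨x, y⟩
  simp only [mem_positions, ofPositions, decide_eq_true_eq]
  exact ⟨fun ⟨_, _, h⟩ => h, fun h => ⟨(mem_square.1 (hE h)).1, (mem_square.1 (hE h)).2, h⟩⟩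

theorem matrixContains_iff_occurs {k n : ℕ} {M : ZeroOneMatrix n n} {π : Equiv.Perm (Fin k)} :
    MatrixContains M (permMatrix π) ↔ Occurs (positions M) π := by
  constructor
  · rintro ⟨r, c, h⟩
    refine ⟨fun i => r i, fun j => c j, fun i j hij => r.strictMono hij,
      fun i j hij => c.strictMono hij, fun j => mem_positions.2 ⟨(r (π j)).2, (c j).2, ?_⟩⟩
    exact h _ _ (by simp [permMatrix])
  · rintro ⟨r, c, hr, hc, h⟩
    simp only [mem_positions] at h
    choose h1 h2 h3 using h
    have h1' : ∀ i, r i < n := fun i => by simpa using h1 (π⁻¹ i)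
    refine ⟨OrderEmbedding.ofStrictMono (fun i => ⟨r i, h1' i⟩) fun i j hij => hr hij,
      OrderEmbedding.ofStrictMono (fun j => ⟨c j, h2 j⟩) fun i j hij => hc hij, fun i j hij => ?_⟩
    obtain rfl : i = π j := by simpa [permMatrix] using hij
    exact h3 j

theorem card_le_ex {k n : ℕ} {π : Equiv.Perm (Fin k)} {E : Finset (ℕ × ℕ)}
    (hE : E ⊆ square n) (h : ¬ Occurs E π) : E.card ≤ ex π n := by
  classical
  rw [← positions_ofPositions hE, card_positions]
  refine Finset.le_sup (f := ones) (Finset.mem_filter.2 ⟨Finset.mem_univ _, ?_⟩)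
  rwa [matrixContains_iff_occurs, positions_ofPositions hE]

theorem exists_card_eq_ex {k : ℕ} (hk : 1 ≤ k) (π : Equiv.Perm (Fin k)) (n : ℕ) :
    ∃ E ⊆ square n, ¬ Occurs E π ∧ E.card = ex π n := by
  classical
  have hne : (Finset.univ.filter fun M : ZeroOneMatrix n n =>
      ¬ MatrixContains M (permMatrix π)).Nonempty := by
    refine ⟨ofPositions n ∅, Finset.mem_filter.2 ⟨Finset.mem_univ _, ?_⟩⟩
    rw [matrixContains_iff_occurs, positions_ofPositions (Finset.empty_subset _)]
    exact not_occurs_empty hk π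
  obtain ⟨M, hM, hMs⟩ := Finset.exists_mem_eq_sup _ hne ones
  refine ⟨positions M, positions_subset M, ?_, ?_⟩
  · rw [← matrixContains_iff_occurs]
    exact (Finset.mem_filter.1 hM).2
  · rw [card_positions, ← hMs]
    unfold ex
    congr!

/-- `E` translated by `v`. -/
def translate (v : ℕ × ℕ) (E : Finset (ℕ × ℕ)) : Finset (ℕ × ℕ) :=
  E.image fun e => e + v

theorem card_translate (v : ℕ × ℕ) (E : Finset (ℕ × ℕ)) : (translate v E).card = E.card :=
  Finset.card_image_of_injective _ (add_left_injective v)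

theorem occurs_of_translate {k : ℕ} {π : Equiv.Perm (Fin k)} {v : ℕ × ℕ} {E : Finset (ℕ × ℕ)}
    (h : Occurs (translate v E) π) : Occurs E π := by
  obtain ⟨r, c, hr, hc, h⟩ := h
  simp only [translate, Finset.mem_image] at h
  choose g hg hgv using h
  simp only [Prod.ext_iff, Prod.fst_add, Prod.snd_add] at hgv
  refine occurs_of_choice g hg (fun i j hij => ?_) (fun i j hij => ?_)
  · have := hc hij
    have h1 := (hgv i).2
    have h2 := (hgv j).2
    omega
  · have := hr hij
    have h1 := (hgv i).1
    have h2 := (hgv j).1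
    omega

/-- Let `E` lie to the left of `F`, and in the row order opposite to that of the first and the last
element of `π`. If `π` occurs in the union of `E` and `F`, then it occurs in one of them. -/
theorem occurs_of_union {k m : ℕ} {π : Equiv.Perm (Fin (k + 1))} {E F : Finset (ℕ × ℕ)}
    (hE : ∀ e ∈ E, e.2 < m) (hF : ∀ e ∈ F, m ≤ e.2)
    (hEF : ∀ e ∈ E, ∀ f ∈ F, (π 0 ≤ π (Fin.last k) → f.1 < e.1) ∧
      (π (Fin.last k) < π 0 → e.1 < f.1))
    (h : Occurs (E ∪ F) π) : Occurs E π ∨ Occurs F π := by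
  obtain ⟨r, c, hr, hc, h⟩ := h
  have hl : ∀ j, c j < m → (r (π j), c j) ∈ E := fun j hj =>
    (Finset.mem_union.1 (h j)).resolve_right fun h' => by have := hF _ h'; simp at this; omega
  have hg : ∀ j, m ≤ c j → (r (π j), c j) ∈ F := fun j hj =>
    (Finset.mem_union.1 (h j)).resolve_left fun h' => by have := hE _ h'; simp at this; omega
  by_cases h0 : c 0 < m
  · left
    by_cases hlast : c (Fin.last k) < m
    · exact ⟨r, c, hr, hc, fun j => hl j ((hc.monotone (Fin.le_last j)).trans_lt hlast)⟩
    · have := hEF _ (hl _ h0) _ (hg _ (not_lt.1 hlast))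
      simp only [hr.lt_iff_lt] at this
      rcases le_or_gt (π 0) (π (Fin.last k)) with h1 | h1
      · exact absurd (this.1 h1) (not_lt.2 h1)
      · exact absurd (this.2 h1) (not_lt.2 h1.le)
  · right
    exact ⟨r, c, hr, hc, fun j => hg j ((not_lt.1 h0).trans (hc.monotone (Fin.zero_le j)))⟩

/-- Two extremal matrices are placed in opposite corners, on the diagonal whose direction disagrees
with the first and last entries of `π`, so no occurrence can use both. -/
theorem ex_add_le {k : ℕ} (hk : 1 ≤ k) (π : Equiv.Perm (Fin k)) (m n : ℕ) :
    ex π m + ex π n ≤ ex π (m + n) := by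
  obtain ⟨E, hE, hEπ, hEc⟩ := exists_card_eq_ex hk π m
  obtain ⟨F, hF, hFπ, hFc⟩ := exists_card_eq_ex hk π n
  obtain ⟨k, rfl⟩ := Nat.exists_eq_add_of_le' hk
  obtain ⟨u, v, hu, hv⟩ : ∃ u v : ℕ, (π 0 ≤ π (Fin.last k) → u = n ∧ v = 0) ∧
      (π (Fin.last k) < π 0 → u = 0 ∧ v = m) := by
    rcases le_or_gt (π 0) (π (Fin.last k)) with h | h
    · exact ⟨n, 0, fun _ => ⟨rfl, rfl⟩, fun h' => absurd h' (not_lt.2 h)⟩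
    · exact ⟨0, m, fun h' => absurd h (not_lt.2 h'), fun _ => ⟨rfl, rfl⟩⟩
  have huv : u ≤ n ∧ v ≤ m := by
    rcases le_or_gt (π 0) (π (Fin.last k)) with h | h
    · have := hu h; omega
    · have := hv h; omega
  have hE' : ∀ e ∈ translate (u, 0) E, u ≤ e.1 ∧ e.1 < m + u ∧ e.2 < m := by
    intro e he
    obtain ⟨e₀, he₀, rfl⟩ := Finset.mem_image.1 he
    have := mem_square.1 (hE he₀)
    simp only [Prod.fst_add, Prod.snd_add]
    omega
  have hF' : ∀ e ∈ translate (v, m) F, v ≤ e.1 ∧ e.1 < n + v ∧ m ≤ e.2 ∧ e.2 < m + n := by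
    intro e he
    obtain ⟨e₀, he₀, rfl⟩ := Finset.mem_image.1 he
    have := mem_square.1 (hF he₀)
    simp only [Prod.fst_add, Prod.snd_add]
    omega
  have hdisj : Disjoint (translate (u, 0) E) (translate (v, m) F) := by
    rw [Finset.disjoint_left]
    intro e he hf
    have := hE' e he
    have := hF' e hf
    omega
  rw [← hEc, ← hFc, ← card_translate (u, 0) E, ← card_translate (v, m) F,
    ← Finset.card_union_of_disjoint hdisj]
  refine card_le_ex ?_ fun h => ?_
  · intro e he
    rw [mem_square]
    rcases Finset.mem_union.1 he with he | he
    · have := hE' e he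
      omega
    · have := hF' e he
      omega
  · refine (occurs_of_union (fun e he => (hE' e he).2.2) (fun e he => (hF' e he).2.2.1)
      (fun e he f hf => ⟨fun h => ?_, fun h => ?_⟩) h).elim
      (fun h => hEπ (occurs_of_translate h)) (fun h => hFπ (occurs_of_translate h))
    · have := hu h
      have := hE' e he
      have := hF' f hf
      omega
    · have := hv h
      have := hE' e he
      have := hF' f hf
      omega

/-! ### The Füredi-Hajnal limit -/

theorem subadditive_neg_ex {k : ℕ} (hk : 1 ≤ k) (π : Equiv.Perm (Fin k)) :
    Subadditive fun n => -(ex π n : ℝ) := by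
  intro m n
  have : (ex π m : ℝ) + ex π n ≤ ex π (m + n) := by exact_mod_cast ex_add_le hk π m n
  linarith

theorem bddBelow_neg_ex_div {k : ℕ} (hk : 1 ≤ k) (π : Equiv.Perm (Fin k)) :
    BddBelow (Set.range fun n : ℕ => -(ex π n : ℝ) / n) := by
  obtain ⟨K, hK⟩ := exists_card_le_of_not_occurs hk π
  refine ⟨-K, ?_⟩
  rintro _ ⟨n, rfl⟩
  obtain ⟨E, hE, hEπ, hEc⟩ := exists_card_eq_ex hk π n
  have h : (ex π n : ℝ) ≤ K * n := by
    rw [← hEc]; exact_mod_cast hK n E hE hEπ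
  simp only [neg_div]
  exact neg_le_neg (div_le_of_le_mul₀ (by positivity) (by positivity) h)

theorem tendsto_ex_div {k : ℕ} (hk : 1 ≤ k) (π : Equiv.Perm (Fin k)) :
    Tendsto (fun n : ℕ => (ex π n : ℝ) / n) atTop (𝓝 (-(subadditive_neg_ex hk π).lim)) := by
  simpa [neg_div] using
    ((subadditive_neg_ex hk π).tendsto_lim (bddBelow_neg_ex_div hk π)).neg

/-- `limUnder` is meaningful only once some limit is known to exist; Fekete's lemma supplies one. -/
theorem tendsto_furediHajnalLimit {k : ℕ} (hk : 1 ≤ k) (π : Equiv.Perm (Fin k)) :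
    Tendsto (fun n : ℕ => (ex π n : ℝ) / n) atTop (𝓝 (furediHajnalLimit π)) :=
  tendsto_nhds_limUnder ⟨_, tendsto_ex_div hk π⟩

theorem ex_le_furediHajnalLimit_mul {k : ℕ} (hk : 1 ≤ k) (π : Equiv.Perm (Fin k)) {n : ℕ}
    (hn : 0 < n) : (ex π n : ℝ) ≤ furediHajnalLimit π * n := by
  have hlim : furediHajnalLimit π = -(subadditive_neg_ex hk π).lim :=
    (tendsto_ex_div hk π).limUnder_eq
  have hle := (subadditive_neg_ex hk π).lim_le_div (bddBelow_neg_ex_div hk π) hn.ne'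
  rw [← div_le_iff₀ (by exact_mod_cast hn), hlim]
  simp only [neg_div] at hle
  linarith

/-! ### Paths and tours -/

/-- The length of the polygonal path through the points of a list. -/
noncomputable def pathLength : List Plane → ℝ
  | [] => 0
  | [_] => 0
  | a :: b :: l => dist a b + pathLength (b :: l)

theorem pathLength_nonneg : ∀ l, 0 ≤ pathLength l
  | [] => le_rfl
  | [_] => le_rfl
  | _ :: b :: l => add_nonneg dist_nonneg (pathLength_nonneg (b :: l))

theorem pathLength_append (x : Plane) (l₂ : List Plane) :
    ∀ l₁, pathLength (l₁ ++ x :: l₂) = pathLength (l₁ ++ [x]) + pathLength (x :: l₂)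
  | [] => by simp [pathLength]
  | [a] => by simp [pathLength]
  | a :: b :: l => by
    have := pathLength_append x l₂ (b :: l)
    simp only [List.cons_append, pathLength] at this ⊢
    rw [this, add_assoc]

/-- A detour from `x` to `q` and back costs `2 * dist q x`; the triangle inequality shortcuts the
return. -/
theorem pathLength_cons_cons_le (x q : Plane) (l : List Plane) :
    pathLength (x :: q :: l) ≤ pathLength (x :: l) + 2 * dist q x := by
  cases l with
  | nil =>
    simp only [pathLength, dist_comm x q]
    linarith [dist_nonneg (x := q) (y := x)]
  | cons y l =>
    simp only [pathLength, dist_comm x q]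
    linarith [dist_triangle q x y]

/-- A new point can be inserted into a path next to a given point of it. -/
theorem exists_insert {l : List Plane} {x : Plane} (hx : x ∈ l) (q : Plane) :
    ∃ l', l'.Perm (q :: l) ∧ pathLength l' ≤ pathLength l + 2 * dist q x := by
  obtain ⟨l₁, l₂, rfl⟩ := List.append_of_mem hx
  refine ⟨l₁ ++ x :: q :: l₂, ?_, ?_⟩
  · exact (List.Perm.append_left l₁ (List.Perm.swap q x l₂)).trans List.perm_middle
  · rw [pathLength_append x (q :: l₂), pathLength_append x l₂]
    linarith [pathLength_cons_cons_le x q l₂]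

/-- A path is extended to the points of `T`, each of which is within `δ` of the path. -/
theorem exists_path_extension {l : List Plane} (hl : l.Nodup) {δ : ℝ} (hδ : 0 ≤ δ)
    (T : Finset Plane) (hT : ∀ t ∈ T, ∃ x ∈ l, dist t x ≤ δ) :
    ∃ l' : List Plane, l'.Nodup ∧ (∀ p, p ∈ l' ↔ p ∈ l ∨ p ∈ T) ∧
      pathLength l' ≤ pathLength l + T.card * (2 * δ) := by
  classical
  induction T using Finset.induction_on with
  | empty => exact ⟨l, hl, by simp, by simp⟩
  | insert q T hq ih =>
    obtain ⟨l', hl', hmem, hlen⟩ := ih fun t ht => hT t (Finset.mem_insert_of_mem ht)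
    rw [Finset.card_insert_of_notMem hq]
    push_cast
    by_cases hql : q ∈ l'
    · refine ⟨l', hl', fun p => ?_, by linarith⟩
      rw [Finset.mem_insert, hmem]
      have := (hmem q).1 hql
      constructor
      · tauto
      · rintro (h | rfl | h) <;> tauto
    -- The anchor `x` is taken on the original path `l`, so distances do not accumulate over the
    -- insertions.
    · obtain ⟨x, hx, hqx⟩ := hT q (Finset.mem_insert_self q T)
      obtain ⟨l'', hperm, hlen'⟩ := exists_insert ((hmem x).2 (Or.inl hx)) q
      refine ⟨l'', hperm.nodup_iff.2 (List.nodup_cons.2 ⟨hql, hl'⟩), fun p => ?_, by linarith⟩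
      rw [hperm.mem_iff, List.mem_cons, hmem, Finset.mem_insert]
      tauto

theorem dist_le_pathLength : ∀ (l : List Plane) (a y : Plane), y ∈ a :: l →
    dist a y ≤ pathLength (a :: l)
  | [], a, y, h => by
    obtain rfl := List.mem_singleton.1 h
    simp [pathLength]
  | b :: l, a, y, h => by
    rcases List.mem_cons.1 h with rfl | h
    · rw [dist_self]; exact pathLength_nonneg _
    · have := dist_le_pathLength l b y h
      rw [pathLength]
      linarith [dist_triangle a b y]

theorem pathLength_ofFn : ∀ (n : ℕ) (g : Fin (n + 1) → Plane),
    pathLength (List.ofFn g) = ∑ i : Fin n, dist (g i.castSucc) (g i.succ)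
  | 0, g => by simp [pathLength]
  | n + 1, g => by
    have := pathLength_ofFn n fun i => g i.succ
    rw [List.ofFn_succ] at this
    rw [List.ofFn_succ, List.ofFn_succ, pathLength, this, Fin.sum_univ_succ]
    rfl

/-- The closing edge joins the two ends of the path, so it is no longer than the path. -/
theorem sum_dist_finRotate_le {n : ℕ} (g : Fin n → Plane) :
    ∑ i, dist (g i) (g (finRotate n i)) ≤ 2 * pathLength (List.ofFn g) := by
  cases n with
  | zero => simp [pathLength]
  | succ n =>
    have h : dist (g (Fin.last n)) (g 0) ≤ pathLength (List.ofFn g) := by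
      rw [dist_comm, List.ofFn_succ]
      refine dist_le_pathLength _ _ _ ?_
      rw [← List.ofFn_succ]
      exact List.mem_ofFn.2 ⟨_, rfl⟩
    rw [Fin.sum_univ_castSucc, finRotate_last]
    simp only [finRotate_apply, Fin.coeSucc_eq_succ]
    rw [← pathLength_ofFn]
    linarith

theorem tsp_le_two_mul_pathLength {P : Finset Plane} {l : List Plane} (hl : l.Nodup)
    (hP : ∀ p, p ∈ l ↔ p ∈ P) : tsp P ≤ 2 * pathLength l := by
  classical
  have hcard : P.card = l.length := by
    rw [← List.toFinset_card_of_nodup hl]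
    congr 1
    ext p
    simp [hP]
  let σ : Fin P.card ≃ P :=
    ((finCongr hcard).trans (hl.getEquiv l)).trans (Equiv.subtypeEquivRight hP)
  have hσ : List.ofFn (fun i => (σ i : Plane)) = l := by
    refine List.ext_get (by simp [hcard]) fun i h₁ h₂ => ?_
    simp [σ]
  calc tsp P ≤ tourLength P σ := ciInf_le (Set.finite_range _).bddBelow σ
    _ ≤ 2 * pathLength (List.ofFn fun i => (σ i : Plane)) :=
      sum_dist_finRotate_le fun i => (σ i : Plane)
    _ = 2 * pathLength l := by rw [hσ]

/-! ### Grid cells -/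

/-- The (row, column) index of the cell of `p` in the grid of mesh `1 / N`. -/
noncomputable def cell (N : ℕ) (p : Plane) : ℕ × ℕ := (⌊(N : ℝ) * p 1⌋₊, ⌊(N : ℝ) * p 0⌋₊)

theorem lt_of_floor_mul_lt {N : ℕ} {a b : ℝ} (h : ⌊(N : ℝ) * a⌋₊ < ⌊(N : ℝ) * b⌋₊) : a < b :=
  lt_of_not_ge fun hba => not_le.2 h (Nat.floor_le_floor (by gcongr))

theorem abs_sub_le_of_floor_mul_eq {N : ℕ} (hN : 0 < N) {a b : ℝ} (ha : 0 ≤ a) (hb : 0 ≤ b)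
    (h : ⌊(N : ℝ) * a⌋₊ = ⌊(N : ℝ) * b⌋₊) : |a - b| ≤ 1 / N := by
  have hN' : (0 : ℝ) < N := by exact_mod_cast hN
  have h1 := Nat.floor_le (mul_nonneg hN'.le ha)
  have h2 := Nat.lt_floor_add_one ((N : ℝ) * a)
  have h3 := Nat.floor_le (mul_nonneg hN'.le hb)
  have h4 := Nat.lt_floor_add_one ((N : ℝ) * b)
  rw [h] at h1 h2
  rw [le_div_iff₀ hN', ← abs_of_pos hN', ← abs_mul, abs_le]
  constructor <;> linarith

theorem dist_le_of_abs_sub_le {p q : Plane} {δ : ℝ} (hx : |p 0 - q 0| ≤ δ)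
    (hy : |p 1 - q 1| ≤ δ) : dist p q ≤ 2 * δ := by
  have hδ : 0 ≤ δ := (abs_nonneg _).trans hx
  rw [EuclideanSpace.dist_eq, Fin.sum_univ_two, Real.dist_eq, Real.dist_eq]
  refine Real.sqrt_le_iff.2 ⟨by positivity, ?_⟩
  have h1 := pow_le_pow_left₀ (abs_nonneg _) hx 2
  have h2 := pow_le_pow_left₀ (abs_nonneg _) hy 2
  nlinarith [sq_nonneg δ]

theorem dist_le_of_cell_eq {P : Finset Plane} (hP : InUnitSquare P) {N : ℕ} (hN : 0 < N)
    {p q : Plane} (hp : p ∈ P) (hq : q ∈ P) (h : cell N p = cell N q) :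
    dist p q ≤ 2 * (1 / N) := by
  obtain ⟨h1, h0⟩ := Prod.ext_iff.1 h
  exact dist_le_of_abs_sub_le (abs_sub_le_of_floor_mul_eq hN (hP p hp).1.1 (hP q hq).1.1 h0)
    (abs_sub_le_of_floor_mul_eq hN (hP p hp).2.1 (hP q hq).2.1 h1)

/-- Side `N + 1` rather than `N`, because a coordinate equal to `1` has index `N`. -/
theorem image_cell_subset {P : Finset Plane} (hP : InUnitSquare P) (N : ℕ) :
    P.image (cell N) ⊆ square (N + 1) := by
  have h : ∀ a ∈ Set.Icc (0 : ℝ) 1, ⌊(N : ℝ) * a⌋₊ < N + 1 := fun a ha =>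
    Nat.lt_succ_of_le (Nat.floor_le_of_le (mul_le_of_le_one_right (by positivity) ha.2))
  intro e he
  obtain ⟨p, hp, rfl⟩ := Finset.mem_image.1 he
  exact mem_square.2 ⟨h _ (hP p hp).2, h _ (hP p hp).1⟩

theorem pointSetContains_of_occurs {k : ℕ} {P : Finset Plane} {π : Equiv.Perm (Fin k)} {N : ℕ}
    (h : Occurs (P.image (cell N)) π) : PointSetContains P π := by
  obtain ⟨r, c, hr, hc, h⟩ := h
  simp only [Finset.mem_image] at h
  choose f hf hcell using h
  have h1 : ∀ j, ⌊(N : ℝ) * f j 1⌋₊ = r (π j) := fun j => congrArg Prod.fst (hcell j)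
  have h0 : ∀ j, ⌊(N : ℝ) * f j 0⌋₊ = c j := fun j => congrArg Prod.snd (hcell j)
  have hlt : ∀ i j, π i < π j → f i 1 < f j 1 := fun i j hij =>
    lt_of_floor_mul_lt (by rw [h1, h1]; exact hr hij)
  refine ⟨f, hf, fun i j hij => lt_of_floor_mul_lt (by rw [h0, h0]; exact hc hij),
    fun i j => ⟨fun hij => ?_, hlt i j⟩⟩
  refine lt_of_le_of_ne (not_lt.1 fun hji => (hlt j i hji).not_gt hij) fun heq => ?_
  rw [π.injective heq] at hij
  exact lt_irrefl _ hij

theorem card_image_cell_le {k : ℕ} (hk : 1 ≤ k) {π : Equiv.Perm (Fin k)} {P : Finset Plane}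
    (hP : InUnitSquare P) (hπ : PointSetAvoids P π) (N : ℕ) :
    ((P.image (cell N)).card : ℝ) ≤ furediHajnalLimit π * (N + 1) := by
  have h1 := card_le_ex (image_cell_subset hP N) fun h => hπ (pointSetContains_of_occurs h)
  have h2 := ex_le_furediHajnalLimit_mul hk π N.succ_pos
  push_cast at h2
  exact (Nat.cast_le.2 h1).trans h2

/-- A set of representatives of the nonempty cells. -/
theorem exists_representatives (P : Finset Plane) (N : ℕ) :
    ∃ T ⊆ P, T.card ≤ (P.image (cell N)).card ∧ ∀ p ∈ P, ∃ t ∈ T, cell N p = cell N t := by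
  classical
  choose! g hgP hg using fun (b : ℕ × ℕ) (hb : b ∈ P.image (cell N)) => Finset.mem_image.1 hb
  refine ⟨(P.image (cell N)).image g, ?_, Finset.card_image_le, fun p hp => ?_⟩
  · intro t ht
    obtain ⟨b, hb, rfl⟩ := Finset.mem_image.1 ht
    exact hgP b hb
  · have hb := Finset.mem_image_of_mem (cell N) hp
    exact ⟨_, Finset.mem_image_of_mem g hb, (hg _ hb).symm⟩

/-- A path through representatives of the cells of the grids of mesh `1, 1/2, …, 1/2 ^ j`. -/
theorem exists_path_of_grid {k : ℕ} (hk : 1 ≤ k) {π : Equiv.Perm (Fin k)} {P : Finset Plane}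
    (hne : P.Nonempty) (hP : InUnitSquare P) (hπ : PointSetAvoids P π) (j : ℕ) :
    ∃ l : List Plane, l.Nodup ∧ (∀ x ∈ l, x ∈ P) ∧
      pathLength l ≤ j * (16 * furediHajnalLimit π) ∧
      ∀ p ∈ P, ∃ x ∈ l, dist p x ≤ 2 * (1 / 2 ^ j) := by
  induction j with
  | zero =>
    obtain ⟨x, hx⟩ := hne
    refine ⟨[x], by simp, by simpa using hx, by simp [pathLength], fun p hp => ⟨x, by simp, ?_⟩⟩
    have h : ∀ a ∈ Set.Icc (0 : ℝ) 1, ∀ b ∈ Set.Icc (0 : ℝ) 1, |a - b| ≤ 1 := fun a ha b hb =>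
      abs_sub_le_iff.2 ⟨by linarith [ha.2, hb.1], by linarith [ha.1, hb.2]⟩
    simpa using dist_le_of_abs_sub_le (h _ (hP p hp).1 _ (hP x hx).1)
      (h _ (hP p hp).2 _ (hP x hx).2)
  | succ j ih =>
    obtain ⟨l, hl, hlP, hlen, hnear⟩ := ih
    obtain ⟨T, hTP, hTc, hT⟩ := exists_representatives P (2 ^ (j + 1))
    obtain ⟨l', hl', hmem, hlen'⟩ := exists_path_extension hl (by positivity) T
      fun t ht => hnear t (hTP ht)
    refine ⟨l', hl', fun x hx => ((hmem x).1 hx).elim (hlP x) (fun h => hTP h), ?_,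
      fun p hp => ?_⟩
    · have hc := card_image_cell_le hk hP hπ (2 ^ (j + 1))
      have hc0 : 0 ≤ furediHajnalLimit π := by
        -- For `N = 0` every point has cell `(0, 0)`, and the bound compares the number of cells
        -- directly with `c_π`.
        have := card_image_cell_le hk hP hπ 0
        have h0 : (0 : ℝ) ≤ ((P.image (cell 0)).card : ℝ) := by positivity
        push_cast at this
        linarith
      have hTc' : (T.card : ℝ) ≤ furediHajnalLimit π * (4 * 2 ^ j) := by
        refine (Nat.cast_le.2 hTc).trans (hc.trans ?_)
        gcongr
        have : (1 : ℝ) ≤ 2 ^ j := one_le_pow₀ (by norm_num)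
        push_cast
        rw [pow_succ]
        linarith
      -- At most `4 * 2 ^ j * c_π` insertions, each costing `4 / 2 ^ j`.
      have h2 : (T.card : ℝ) * (2 * (2 * (1 / 2 ^ j))) ≤ 16 * furediHajnalLimit π := by
        refine (mul_le_mul_of_nonneg_right hTc' (by positivity)).trans_eq ?_
        field_simp
        ring
      push_cast
      linarith
    · obtain ⟨t, ht, hpt⟩ := hT p hp
      refine ⟨t, (hmem t).2 (Or.inr ht), ?_⟩
      simpa using dist_le_of_cell_eq hP (by positivity) hp (hTP ht) hpt

theorem tsp_le_of_grid {k : ℕ} (hk : 1 ≤ k) {π : Equiv.Perm (Fin k)} {P : Finset Plane}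
    (hne : P.Nonempty) (hP : InUnitSquare P) (hπ : PointSetAvoids P π) {j : ℕ}
    (hj : P.card ≤ 2 ^ j) : tsp P ≤ 32 * furediHajnalLimit π * j + 8 := by
  obtain ⟨l, hl, hlP, hlen, hnear⟩ := exists_path_of_grid hk hne hP hπ j
  obtain ⟨l', hl', hmem, hlen'⟩ := exists_path_extension hl (by positivity) P hnear
  have h1 : (P.card : ℝ) * (2 * (2 * (1 / 2 ^ j))) ≤ 4 := by
    have : (P.card : ℝ) ≤ 2 ^ j := by exact_mod_cast hj
    refine (mul_le_mul_of_nonneg_right this (by positivity)).trans_eq ?_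
    field_simp
    norm_num
  have h2 := tsp_le_two_mul_pathLength hl' (P := P) fun p => by
    rw [hmem]
    exact ⟨fun h => h.elim (hlP p) id, Or.inr⟩
  linarith

theorem tsp_of_card_le_one {P : Finset Plane} (h : P.card ≤ 1) : tsp P ≤ 0 := by
  obtain ⟨x, hx⟩ := Finset.card_le_one_iff_subset_singleton.1 h
  have := tsp_le_two_mul_pathLength (P := P) P.nodup_toList fun p => Finset.mem_toList
  rcases Finset.subset_singleton_iff.1 hx with rfl | rfl <;> simpa [pathLength] using this

/-- Rounding up gives at most `log₂ n + 1 ≤ 2 * log₂ n`, and `2 / log 2 < 3`. -/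
theorem clog_two_le_log {n : ℕ} (hn : 2 ≤ n) : (Nat.clog 2 n : ℝ) ≤ 3 * Real.log n := by
  have hn' : (2 : ℝ) ≤ n := by exact_mod_cast hn
  have h1 : 2 ^ (Nat.clog 2 n - 1) < n := Nat.pow_pred_clog_lt_self (by norm_num) (by omega)
  have h2 : ((Nat.clog 2 n - 1 : ℕ) : ℝ) * Real.log 2 ≤ Real.log n := by
    rw [← Real.log_pow]
    exact Real.log_le_log (by positivity) (by exact_mod_cast h1.le)
  have h3 : (Nat.clog 2 n : ℝ) ≤ ((Nat.clog 2 n - 1 : ℕ) : ℝ) + 1 := by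
    exact_mod_cast (by omega : Nat.clog 2 n ≤ Nat.clog 2 n - 1 + 1)
  have h4 := Real.log_le_log (by norm_num) hn'
  have h5 := Real.log_two_gt_d9
  have h6 : (0 : ℝ) ≤ ((Nat.clog 2 n - 1 : ℕ) : ℝ) := by positivity
  nlinarith

theorem tsp_le {k : ℕ} (hk : 1 ≤ k) {π : Equiv.Perm (Fin k)} {P : Finset Plane}
    (hP : InUnitSquare P) (hπ : PointSetAvoids P π) :
    tsp P ≤ 200 * furediHajnalLimit π * Real.log P.card := by
  rcases le_or_gt P.card 1 with h | h
  · have hlog : Real.log P.card = 0 := by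
      interval_cases P.card <;> simp
    rw [hlog, mul_zero]
    exact tsp_of_card_le_one h
  have hne : P.Nonempty := Finset.card_pos.1 (by omega)
  have hc : 1 ≤ furediHajnalLimit π := by
    have h1 := card_image_cell_le hk hP hπ 0
    have h2 : (1 : ℝ) ≤ ((P.image (cell 0)).card : ℝ) := by
      exact_mod_cast (hne.image _).card_pos
    push_cast at h1
    linarith
  have h1 := tsp_le_of_grid hk hne hP hπ (Nat.le_pow_clog (by norm_num) P.card)
  have h2 := mul_le_mul_of_nonneg_left (clog_two_le_log h) (by linarith : 0 ≤ furediHajnalLimit π)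
  have h3 : (0.5 : ℝ) ≤ Real.log P.card := by
    have := Real.log_le_log (by norm_num) (by exact_mod_cast h : (2 : ℝ) ≤ P.card)
    linarith [Real.log_two_gt_d9]
  -- From `c_π ≥ 1` and `log |P| ≥ 1 / 2`, the additive `8` is at most `16 * c_π * log |P|`; with
  -- `32 * 3 = 96` the total stays below `200`.
  have h4 := mul_le_mul hc h3 (by norm_num) (by linarith)
  linarith

end PatternTSP

theorem mainTheorem3 :
    ∃ C : ℝ, 0 < C ∧
      ∀ (k : ℕ), 1 ≤ k → ∀ (π : Equiv.Perm (Fin k)),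
        Tendsto (fun n : ℕ => (PatternTSP.ex π n : ℝ) / n) atTop
          (𝓝 (PatternTSP.furediHajnalLimit π)) ∧
        ∀ P : Finset PatternTSP.Plane,
          PatternTSP.InUnitSquare P → PatternTSP.GeneralPosition P →
          PatternTSP.PointSetAvoids P π →
          PatternTSP.tsp P ≤ C * PatternTSP.furediHajnalLimit π * Real.log (P.card : ℝ) :=
  ⟨200, by norm_num, fun _ hk π => ⟨PatternTSP.tendsto_furediHajnalLimit hk π,
    fun _ hP _ hπ => PatternTSP.tsp_le hk hP hπ⟩⟩
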